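/- **Conventions.** $\mathbb D$ is the open unit disk of $\mathbb C$, $D(a,r)$ the closed disk with center $a$ and radius $r$, $\mathrm d(z,a)=|z-a|$, $\mathbb U_4=\{\pm1,\pm i\}$, and $\mathbb D_8$ is the group of isometries of $\mathbb C$ generated by the multiplications by elements of $\mathbb U_4$ and by complex conjugation. A Gauss lattice in $\mathbb C^2$ is a discrete $\mathbb Z[i]$-submodule of $\mathbb C^2$ that spans $\mathbb C^2$ over $\mathbb C$; it is unimodular if it has a $\mathbb Z[i]$-basis with determinant in $\mathbb U_4$. **Transversals.** Let $T$ be the set of unimodular Gauss lattices $\Lambda$ in $\mathbb C^2$ for which there are $u=(u_1,u_2)$ and $v=(v_1,v_2)$ in $\Lambda$, called vectors associated with $\Lambda$, such that $|u_2|,|v_1|<|u_1|=|v_2|=r$ and the only nonzero vectors of $\Lambda$ in the closed ball of radius $r$ centered at $0$ for the sup norm $\max(|z_1|,|z_2|)$ are those of $\mathbb U_4u\cup\mathbb U_4v$. For $k=1,2$ let $T_k$ be the set of $\Lambda\in T$ such that $\mathbb Z[i]u+\mathbb Z[i]v$ has index $k$ in $\Lambda$ for associated vectors $u,v$. **Parametrizations.**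 For $k\in\{1,2\}$, $\theta\in\mathbb R$ and $w_1,w_2\in\mathbb D$ put $$r=\frac{k^{1/4}}{\sqrt{|1-w_1w_2|}},\quad u_1=e^{i\theta},\quad v_2=\exp\Big(i\big((k-1)\tfrac{\pi}{4}-\theta-\arg(1-w_1w_2)\big)\Big),$$ $u=r(u_1,v_2w_2)$, $v=r(u_1w_1,v_2)$, $C_k(\theta,w_1,w_2)=\{(z_1,z_2)\in\mathbb C^2:|z_1|\le\max(|ru_1|,|ru_1w_1|),\ |z_2|\le\max(|rv_2w_2|,|rv_2|)\}$, with interior $\overset{o}{C}_k(\theta,w_1,w_2)$, and $$\Psi_1(\theta,w_1,w_2)=\mathbb Z[i]u+\mathbb Z[i]v\ \ (k=1),\qquad \Psi_2(\theta,w_1,w_2)=\mathbb Z[i]u+\tfrac1{1+i}\mathbb Z[i](u+v)\ \ (k=2).$$ **Regions.** Let $$\mathcal C=\{z:|z|<1,\ \arg z\in[0,\tfrac\pi4]\}\ \text{ (with }0\in\mathcal C\text{)},$$ $$\mathcal D=\{z:|z|<1,\ \mathrm d(z,1)>1,\ \mathrm d(z,1-i)>1\},\quad \mathcal T=\{z:|z|<1,\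 \mathrm d(z,1)>\sqrt2,\ \mathrm d(z,-i)>\sqrt2\},$$ and let $R_1=D(i,1)$, $R_2=D(-i,1)$, $B_1=D(\tfrac{1-i}2,\tfrac1{\sqrt2})$, $B_2=D(1+i,1)$, $G_1=D(1+i,1)$, $G_2=D(\tfrac{1-i}2,\tfrac1{\sqrt2})$. Let $W_1^0$ be the set of $(w_1,w_2)\in\mathcal C\times\mathcal D$ for which one of the following holds: 1. $w_2\in G_2$ and $w_1\notin R_1\cup G_1$; 2. $w_2\in R_2\setminus G_2$ and $w_1\notin R_1$; 3. $w_2\notin R_2\cup B_2$ and $w_1\ne0$; 4. $w_2\in B_2$ and $w_1\notin B_1$. Let $W_2^0=(\mathcal C\setminus D(-i,\sqrt2))\times\mathcal T$, and for $k=1,2$ let $$W_k=\Big\{\big(\varphi(w_1),\tfrac1{\varphi(1)^2}\varphi(w_2)\big):\varphi\in\mathbb D_8,\ (w_1,w_2)\in W_k^0\Big\}.$$ **Theorem.** Let $(\theta,w_1,w_2)\in[0,\tfrac\pi2[\,\times\mathbb D^2$. Then - $\Psi_1(\theta,w_1,w_2)\in T_1$ and $\Psi_1(\theta,w_1,w_2)\cap\overset{o}{C}_1(\theta,w_1,w_2)=\{0\}$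 if and only if $(w_1,w_2)\in W_1$; - $\Psi_2(\theta,w_1,w_2)\in T_2$ and $\Psi_2(\theta,w_1,w_2)\cap\overset{o}{C}_2(\theta,w_1,w_2)=\{0\}$ if and only if $(w_1,w_2)\in W_2$. -/

import Mathlib

namespace GaussTransversal

/-- `ℂ` as an algebra over the Gaussian integers, through the inclusion `ℤ[i] ⊆ ℂ`. It makes
`ℂ × ℂ` a module over the Gaussian integers. -/
noncomputable instance instAlgebraGaussianIntComplex : Algebra GaussianInt ℂ :=
  GaussianInt.toComplex.toAlgebra

/-- The determinant of the matrix with columns `u` and `v`. -/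
def det (u v : ℂ × ℂ) : ℂ := u.1 * v.2 - u.2 * v.1

/-- A Gauss lattice in `ℂ²`: a discrete `ℤ[i]`-submodule that generates `ℂ²` over `ℂ`. -/
structure IsGaussLattice (L : Submodule GaussianInt (ℂ × ℂ)) : Prop where
  discrete : DiscreteTopology L
  spans : Submodule.span ℂ (L : Set (ℂ × ℂ)) = ⊤

/-- A unimodular Gauss lattice: one that has a `ℤ[i]`-basis with determinant in
`{1, -1, i, -i}`. (A generating pair with nonzero determinant is a basis.) -/
structure IsUnimodular (L : Submodule GaussianInt (ℂ × ℂ)) : Prop where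
  isGaussLattice : IsGaussLattice L
  exists_basis : ∃ a b : ℂ × ℂ, L = Submodule.span GaussianInt {a, b} ∧ det a b ^ 4 = 1

/-- The vectors `u` and `v` are associated with the lattice `L`: they lie in `L`,
`|u₂|, |v₁| < |u₁| = |v₂| = r`, and the only nonzero vectors of `L` in the closed ball of radius
`r` for the sup norm (the norm of `ℂ × ℂ`) are the products of `u` and of `v` by the fourth roots
of unity. -/
def IsAssociated (L : Submodule GaussianInt (ℂ × ℂ)) (u v : ℂ × ℂ) : Prop :=
  u ∈ L ∧ v ∈ L ∧ ∃ r : ℝ, ‖u.1‖ = r ∧ ‖v.2‖ = r ∧ ‖u.2‖ < r ∧ ‖v.1‖ < r ∧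
    ∀ z ∈ L, z ≠ 0 → z ∈ Metric.closedBall (0 : ℂ × ℂ) r →
      ∃ ω : ℂ, ω ^ 4 = 1 ∧ (z = ω • u ∨ z = ω • v)

/-- The open transversal `T`. -/
def T : Set (Submodule GaussianInt (ℂ × ℂ)) :=
  {L | IsUnimodular L ∧ ∃ u v : ℂ × ℂ, IsAssociated L u v}

/-- The piece `T_k` of the open transversal: the lattices with associated vectors `u`, `v` such
that `ℤ[i]u + ℤ[i]v` has index `k`. -/
def TPiece (k : ℕ) : Set (Submodule GaussianInt (ℂ × ℂ)) :=
  {L | L ∈ T ∧ ∃ u v : ℂ × ℂ, IsAssociated L u v ∧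
    (Submodule.span GaussianInt {u, v}).toAddSubgroup.relIndex L.toAddSubgroup = k}

/-- The cylinder `C(u, v)`. -/
def cylinder (u v : ℂ × ℂ) : Set (ℂ × ℂ) :=
  {z | ‖z.1‖ ≤ max ‖u.1‖ ‖v.1‖ ∧ ‖z.2‖ ≤ max ‖u.2‖ ‖v.2‖}

/-- `r = k^(1/4) / √|1 - w₁w₂|`. -/
noncomputable def radius (k : ℕ) (w₁ w₂ : ℂ) : ℝ :=
  (k : ℝ) ^ (1 / 4 : ℝ) / √‖1 - w₁ * w₂‖

/-- `u₁ = exp(iθ)`. -/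
noncomputable def uCoord (θ : ℝ) : ℂ := Complex.exp (Complex.I * θ)

/-- `v₂ = exp(i((k - 1)π/4 - θ - arg(1 - w₁w₂)))`. -/
noncomputable def vCoord (k : ℕ) (θ : ℝ) (w₁ w₂ : ℂ) : ℂ :=
  Complex.exp (Complex.I *
    ((((k : ℝ) - 1) * (Real.pi / 4) - θ - Complex.arg (1 - w₁ * w₂) : ℝ) : ℂ))

/-- `u = r(u₁, v₂w₂)`. -/
noncomputable def uVec (k : ℕ) (θ : ℝ) (w₁ w₂ : ℂ) : ℂ × ℂ :=
  radius k w₁ w₂ • (uCoord θ, vCoord k θ w₁ w₂ * w₂)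

/-- `v = r(u₁w₁, v₂)`. -/
noncomputable def vVec (k : ℕ) (θ : ℝ) (w₁ w₂ : ℂ) : ℂ × ℂ :=
  radius k w₁ w₂ • (uCoord θ * w₁, vCoord k θ w₁ w₂)

/-- `Ψ₁(θ, w₁, w₂) = ℤ[i]u + ℤ[i]v`, with `k = 1`. -/
noncomputable def Psi₁ (θ : ℝ) (w₁ w₂ : ℂ) : Submodule GaussianInt (ℂ × ℂ) :=
  Submodule.span GaussianInt {uVec 1 θ w₁ w₂, vVec 1 θ w₁ w₂}

/-- `Ψ₂(θ, w₁, w₂) = ℤ[i]u + (1/(1+i))ℤ[i](u + v)`, with `k = 2`. -/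
noncomputable def Psi₂ (θ : ℝ) (w₁ w₂ : ℂ) : Submodule GaussianInt (ℂ × ℂ) :=
  Submodule.span GaussianInt
    {uVec 2 θ w₁ w₂, (1 / (1 + Complex.I)) • (uVec 2 θ w₁ w₂ + vVec 2 θ w₁ w₂)}

/-- The cylinder `C_k(θ, w₁, w₂) = C(u, v)`. -/
noncomputable def Cyl (k : ℕ) (θ : ℝ) (w₁ w₂ : ℂ) : Set (ℂ × ℂ) :=
  cylinder (uVec k θ w₁ w₂) (vVec k θ w₁ w₂)

/-- The group `𝔻₈` of isometries of `ℂ` generated by the multiplications by fourth roots of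
unity and by the conjugation. -/
noncomputable def D₈ : Subgroup (ℂ ≃ₗᵢ[ℝ] ℂ) :=
  Subgroup.closure
    ({φ | ∃ α : ℂ, α ^ 4 = 1 ∧ ∀ z : ℂ, φ z = α * z} ∪ {Complex.conjLIE})

/-- The sector `𝒞`. -/
def sectorC : Set ℂ := {z | ‖z‖ < 1 ∧ Complex.arg z ∈ Set.Icc 0 (Real.pi / 4)}

/-- The region `𝒟`. -/
def regionD : Set ℂ := {z | ‖z‖ < 1 ∧ 1 < dist z 1 ∧ 1 < dist z (1 - Complex.I)}

/-- The region `𝒯`. -/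
def regionT : Set ℂ := {z | ‖z‖ < 1 ∧ √2 < dist z 1 ∧ √2 < dist z (-Complex.I)}

/-- Closed disks. -/
def Red₁ : Set ℂ := Metric.closedBall Complex.I 1
def Red₂ : Set ℂ := Metric.closedBall (-Complex.I) 1
noncomputable def Blue₁ : Set ℂ := Metric.closedBall ((1 - Complex.I) / 2) (1 / √2)
def Blue₂ : Set ℂ := Metric.closedBall (1 + Complex.I) 1
def Green₁ : Set ℂ := Metric.closedBall (1 + Complex.I) 1
noncomputable def Green₂ : Set ℂ := Metric.closedBall ((1 - Complex.I) / 2) (1 / √2)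

/-- The region `W₁⁰ ⊆ 𝒞 × 𝒟`. -/
def W₁zero : Set (ℂ × ℂ) :=
  {w | w.1 ∈ sectorC ∧ w.2 ∈ regionD ∧
    ((w.2 ∈ Green₂ ∧ w.1 ∉ Red₁ ∪ Green₁) ∨
     (w.2 ∈ Red₂ \ Green₂ ∧ w.1 ∉ Red₁) ∨
     (w.2 ∉ Red₂ ∪ Blue₂ ∧ w.1 ≠ 0) ∨
     (w.2 ∈ Blue₂ ∧ w.1 ∉ Blue₁))}

/-- The region `W₂⁰ = (𝒞 \ D(-i, √2)) × 𝒯`. -/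
def W₂zero : Set (ℂ × ℂ) :=
  (sectorC \ Metric.closedBall (-Complex.I) (√2)) ×ˢ regionT

/-- `{(φ(w₁), φ(w₂)/φ(1)²) : φ ∈ 𝔻₈, (w₁, w₂) ∈ W}`. -/
def orbit (W : Set (ℂ × ℂ)) : Set (ℂ × ℂ) :=
  {p | ∃ φ ∈ D₈, ∃ w ∈ W, p = (φ w.1, 1 / φ 1 ^ 2 * φ w.2)}

def W₁ : Set (ℂ × ℂ) := orbit W₁zero

def W₂ : Set (ℂ × ℂ) := orbit W₂zero

end GaussTransversal

namespace GaussTransversal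

/-! ### Gauss lattices and associated vectors -/

/-! Both equivalences come down to one arithmetic condition. If the lattice misses the open
cylinder, any associated pair must agree with the given `u`, `v` up to fourth roots of unity, so the
left-hand side says that `u` and `v` are themselves associated (`isAssociated_iff`). Every lattice
vector is `(p u + q v) / c` with Gaussian integers `p ≡ q` mod `c`, where `c = 1` for `Ψ₁` and `c =
1 + i` for `Ψ₂`. After division by the radius its coordinates have moduli `|p + q w₁| / |c|` and `|p
w₂ + q| / |c|`, so the condition is `Admissible c w₁ w₂`: for `p q ≠ 0` the two moduli are never
both at most 1. The parameter `θ` has disappeared; unimodularity and the index hold for all `w₁, w₂`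
in the disk.

Admissibility is invariant under `(w₁, w₂) ↦ (α w₁, α⁻¹ w₂)` with `α ^ 4 = 1` and under simultaneous
conjugation, so `w₁` may be taken in the sector `𝒞` (`admissible_iff_mem_orbit`). There a handful of
pairs `(p, q)` already force the inequalities that define `W_k⁰`. Conversely these inequalities give
`|1 - w₁w₂|² ≥ |c|² / 2`, hence `|p|², |q|² < 8` for any offending pair. The finitely many remaining
pairs are excluded by arithmetic that is linear in the coordinates and squared moduli of `w₁`, `w₂`
(`false_of_small_one`, `false_of_small_two`). -/

theorem smul_prod_eq (a : GaussianInt) (z : ℂ × ℂ) : a • z = ((a : ℂ) * z.1, (a : ℂ) * z.2) := rfl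

theorem smul_eq_toComplex_mul (a : GaussianInt) (z : ℂ) : a • z = (a : ℂ) * z := rfl

theorem gaussianInt_smul_left_cancel {c : GaussianInt} (hc : c ≠ 0) {x y : ℂ × ℂ}
    (h : c • x = c • y) : x = y := by
  have hc' : (c : ℂ) ≠ 0 := mt GaussianInt.toComplex_eq_zero.1 hc
  rw [smul_prod_eq c x, smul_prod_eq c y, Prod.mk.injEq] at h
  exact Prod.ext (mul_left_cancel₀ hc' h.1) (mul_left_cancel₀ hc' h.2)

theorem mem_span_gaussianInt_pair {a b z : ℂ × ℂ} :
    z ∈ Submodule.span GaussianInt {a, b} ↔ ∃ m n : GaussianInt, m • a + n • b = z :=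
  Submodule.mem_span_pair

theorem norm_eq_one_of_pow_four {ω : ℂ} (h : ω ^ 4 = 1) : ‖ω‖ = 1 :=
  (pow_eq_one_iff_of_nonneg (norm_nonneg ω) four_ne_zero).1 (by rw [← norm_pow, h, norm_one])

theorem eq_of_pow_four {α : ℂ} (h : α ^ 4 = 1) :
    α = 1 ∨ α = -1 ∨ α = Complex.I ∨ α = -Complex.I := by
  have h' : (α - 1) * ((α + 1) * ((α - Complex.I) * (α + Complex.I))) = 0 := by
    linear_combination h - (α ^ 2 - 1) * Complex.I_sq
  rcases mul_eq_zero.1 h' with h | h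
  · exact Or.inl (sub_eq_zero.1 h)
  rcases mul_eq_zero.1 h with h | h
  · exact Or.inr (Or.inl (eq_neg_of_add_eq_zero_left h))
  rcases mul_eq_zero.1 h with h | h
  · exact Or.inr (Or.inr (Or.inl (sub_eq_zero.1 h)))
  · exact Or.inr (Or.inr (Or.inr (eq_neg_of_add_eq_zero_left h)))

theorem one_le_norm_toComplex {a : GaussianInt} (ha : a ≠ 0) : 1 ≤ ‖(a : ℂ)‖ := by
  have h1 : (0 : ℤ) < a.norm := GaussianInt.norm_pos.2 ha
  have h2 : (1 : ℝ) ≤ Complex.normSq (a : ℂ) := by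
    rw [← GaussianInt.intCast_real_norm]; exact_mod_cast h1
  rw [Complex.normSq_eq_norm_sq] at h2
  nlinarith [norm_nonneg (a : ℂ)]

theorem toComplex_pow_four {a : GaussianInt} (ha : a ≠ 0) (h : ‖(a : ℂ)‖ ≤ 1) :
    (a : ℂ) ^ 4 = 1 := by
  have h2 : Complex.normSq (a : ℂ) = 1 := by
    rw [Complex.normSq_eq_norm_sq, le_antisymm h (one_le_norm_toComplex ha), one_pow]
  rw [← GaussianInt.intCast_real_norm] at h2
  have h3 : a.norm = 1 := by exact_mod_cast h2
  obtain ⟨m, n⟩ := a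
  replace h3 : m ^ 2 + n ^ 2 = 1 := by rw [← h3, Zsqrtd.norm]; ring
  have hm : m ≤ 1 := by nlinarith
  have hn : n ≤ 1 := by nlinarith
  have hm' : -1 ≤ m := by nlinarith
  have hn' : -1 ≤ n := by nlinarith
  have key : (⟨m, n⟩ : GaussianInt) ^ 4 = 1 := by
    interval_cases m <;> interval_cases n <;> first | (exfalso; revert h3; norm_num; done) | rfl
  rw [← map_pow, key, map_one]

theorem det_smul_eq (a b z : ℂ × ℂ) : det a b • z = det z b • a + det a z • b := by
  ext <;> simp [det] <;> ring

theorem det_smul_add_left (a b : ℂ × ℂ) (m n : GaussianInt) :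
    det (m • a + n • b) b = m * det a b := by
  simp [det, smul_eq_toComplex_mul]; ring

theorem det_smul_add_right (a b : ℂ × ℂ) (m n : GaussianInt) :
    det a (m • a + n • b) = n * det a b := by
  simp [det, smul_eq_toComplex_mul]; ring

theorem norm_det_le (z w : ℂ × ℂ) : ‖det z w‖ ≤ 2 * ‖z‖ * ‖w‖ := by
  have h := norm_sub_le (z.1 * w.2) (z.2 * w.1)
  rw [norm_mul, norm_mul] at h
  have h1 := mul_le_mul (norm_fst_le z) (norm_snd_le w) (norm_nonneg _) (norm_nonneg _)
  have h2 := mul_le_mul (norm_snd_le z) (norm_fst_le w) (norm_nonneg _) (norm_nonneg _)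
  unfold det; linarith

/-- For `z = m a + n b`, Cramer's rule gives `m det a b = det z b` and `n det a b = det a z`. A
short `z` makes both right-hand sides smaller than `|det a b|`, and a Gaussian integer of modulus
less than 1 is 0. -/
theorem isGaussLattice_span_pair {a b : ℂ × ℂ} (h : det a b ≠ 0) :
    IsGaussLattice (Submodule.span GaussianInt {a, b}) := by
  have hd : 0 < ‖det a b‖ := norm_pos_iff.2 h
  constructor
  · refine discreteTopology_of_isOpen_singleton_zero
      (G := Submodule.span GaussianInt ({a, b} : Set (ℂ × ℂ))) ?_
    rw [Metric.isOpen_singleton_iff]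
    refine ⟨‖det a b‖ / (2 * (‖a‖ + ‖b‖ + 1)), by positivity, ?_⟩
    rintro ⟨z, hz⟩ hdist
    obtain ⟨m, n, rfl⟩ := mem_span_gaussianInt_pair.1 hz
    have hlt : ‖m • a + n • b‖ * (2 * (‖a‖ + ‖b‖ + 1)) < ‖det a b‖ := by
      rw [← lt_div_iff₀ (by positivity)]
      simpa [dist_eq_norm] using hdist
    have h1 := norm_det_le (m • a + n • b) b
    have h2 := norm_det_le a (m • a + n • b)
    rw [det_smul_add_left, norm_mul] at h1
    rw [det_smul_add_right, norm_mul] at h2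
    have hz0 := norm_nonneg (m • a + n • b)
    have hm : m = 0 := by
      by_contra hm
      nlinarith [one_le_norm_toComplex hm, norm_nonneg a, norm_nonneg b,
        mul_nonneg hz0 (norm_nonneg a)]
    have hn : n = 0 := by
      by_contra hn
      nlinarith [one_le_norm_toComplex hn, norm_nonneg a, norm_nonneg b,
        mul_nonneg hz0 (norm_nonneg b)]
    simp [hm, hn]
  · rw [eq_top_iff]
    rintro z -
    have hz : z = (det a b)⁻¹ • (det z b • a + det a z • b) := by
      rw [← det_smul_eq, smul_smul, inv_mul_cancel₀ h, one_smul]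
    rw [hz]
    refine Submodule.smul_mem _ _ (Submodule.add_mem _ (Submodule.smul_mem _ _ ?_)
      (Submodule.smul_mem _ _ ?_)) <;>
    exact Submodule.subset_span (Submodule.subset_span (by simp))

theorem isUnimodular_span_pair {a b : ℂ × ℂ} (h : det a b ^ 4 = 1) :
    IsUnimodular (Submodule.span GaussianInt {a, b}) :=
  ⟨isGaussLattice_span_pair fun h0 => by simp [h0] at h, a, b, rfl, h⟩

theorem interior_cylinder {u v : ℂ × ℂ} {r : ℝ} (hr : 0 < r) (hu : ‖u.1‖ = r) (hv : ‖v.2‖ = r)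
    (hu' : ‖u.2‖ < r) (hv' : ‖v.1‖ < r) :
    interior (cylinder u v) = Metric.ball 0 r := by
  have : cylinder u v = Metric.closedBall 0 r := by
    ext z
    simp only [cylinder, Set.mem_ofPred_eq, hu, hv, max_eq_left hv'.le, max_eq_right hu'.le,
      mem_closedBall_zero_iff, Prod.norm_def, max_le_iff]
  rw [this, interior_closedBall _ hr.ne']

/-- A lattice meets the open ball trivially and has associated vectors exactly when the given
vectors on the boundary of the ball are associated with it. -/
theorem isAssociated_iff {L : Submodule GaussianInt (ℂ × ℂ)} {u v : ℂ × ℂ} {r : ℝ}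
    (hr : 0 < r) (huL : u ∈ L) (hvL : v ∈ L) (hu : ‖u.1‖ = r) (hv : ‖v.2‖ = r)
    (hu' : ‖u.2‖ < r) (hv' : ‖v.1‖ < r) :
    ((∃ u' v', IsAssociated L u' v') ∧ (L : Set (ℂ × ℂ)) ∩ Metric.ball 0 r = {0}) ↔
      IsAssociated L u v := by
  have nu : ‖u‖ = r := by rw [Prod.norm_def, hu, max_eq_left hu'.le]
  have nv : ‖v‖ = r := by rw [Prod.norm_def, hv, max_eq_right hv'.le]
  have u0 : u ≠ 0 := by rintro rfl; simp at nu; exact hr.ne nu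
  have v0 : v ≠ 0 := by rintro rfl; simp at nv; exact hr.ne nv
  constructor
  · rintro ⟨⟨u', v', hu'L, -, s, hs1, hs2, hs3, hs4, H⟩, hint⟩
    have nu' : ‖u'‖ = s := by rw [Prod.norm_def, hs1, max_eq_left hs3.le]
    have nv' : ‖v'‖ = s := by rw [Prod.norm_def, hs2, max_eq_right hs4.le]
    -- Otherwise `u'` would be a nonzero lattice vector in the open ball of radius `r`. Once `r ≤
    -- s`, the vectors `u` and `v` lie in the ball of radius `s` and are therefore unit multiples of
    -- `u'` or `v'`; the strict inequalities on the small coordinates decide which.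
    have hrs : r ≤ s := by
      by_contra! hlt
      have : u' ∈ ((L : Set (ℂ × ℂ)) ∩ Metric.ball 0 r) :=
        ⟨hu'L, by rw [mem_ball_zero_iff, nu']; exact hlt⟩
      rw [hint, Set.mem_singleton_iff] at this
      subst this
      simp only [Prod.fst_zero, Prod.snd_zero, norm_zero] at hs1 hs3
      linarith
    obtain ⟨ω, hω, hωu⟩ := H u huL u0 (by rw [mem_closedBall_zero_iff, nu]; exact hrs)
    obtain ⟨η, hη, hηv⟩ := H v hvL v0 (by rw [mem_closedBall_zero_iff, nv]; exact hrs)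
    have nω := norm_eq_one_of_pow_four hω
    have nη := norm_eq_one_of_pow_four hη
    have hsr : r = s := by
      rcases hωu with h | h <;> rw [h, norm_smul, nω, one_mul] at nu
      · rw [← nu, nu']
      · rw [← nu, nv']
    subst hsr
    have hωu : u = ω • u' := by
      refine hωu.resolve_right fun h => ?_
      rw [h, Prod.smul_fst, norm_smul, nω, one_mul] at hu
      exact hs4.ne hu
    have hηv : v = η • v' := by
      refine hηv.resolve_left fun h => ?_
      rw [h, Prod.smul_snd, norm_smul, nη, one_mul] at hv
      exact hs3.ne hv
    have ω0 : ω ≠ 0 := by rintro rfl; simp at hω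
    have η0 : η ≠ 0 := by rintro rfl; simp at hη
    refine ⟨huL, hvL, r, hu, hv, hu', hv', fun z hz z0 hzr => ?_⟩
    obtain ⟨μ, hμ, h | h⟩ := H z hz z0 hzr
    · refine ⟨μ * ω⁻¹, by rw [mul_pow, inv_pow, hμ, hω]; simp, Or.inl ?_⟩
      rw [h, hωu, smul_smul, mul_assoc, inv_mul_cancel₀ ω0, mul_one]
    · refine ⟨μ * η⁻¹, by rw [mul_pow, inv_pow, hμ, hη]; simp, Or.inr ?_⟩
      rw [h, hηv, smul_smul, mul_assoc, inv_mul_cancel₀ η0, mul_one]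
  · intro h
    refine ⟨⟨u, v, h⟩, ?_⟩
    obtain ⟨-, -, s, hs, -, -, -, H⟩ := h
    have hsr : s = r := hs.symm.trans hu
    subst hsr
    refine Set.eq_singleton_iff_unique_mem.2 ⟨⟨L.zero_mem, Metric.mem_ball_self hr⟩, ?_⟩
    rintro z ⟨hz, hzr⟩
    by_contra z0
    obtain ⟨ω, hω, h⟩ := H z hz z0 (Metric.ball_subset_closedBall hzr)
    rw [mem_ball_zero_iff] at hzr
    rcases h with h | h <;> rw [h, norm_smul, norm_eq_one_of_pow_four hω, one_mul] at hzr <;>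
      linarith

/-- No vector `(p u + q v) / c` with `p q ≠ 0` lies in the closed unit ball, for `u = (1, w₂)` and
`v = (w₁, 1)`. -/
def Admissible (c : GaussianInt) (w₁ w₂ : ℂ) : Prop :=
  ∀ p q : GaussianInt, p ≠ 0 → q ≠ 0 → c ∣ p - q →
    ‖(c : ℂ)‖ < ‖(p : ℂ) + q * w₁‖ ∨ ‖(c : ℂ)‖ < ‖(p : ℂ) * w₂ + q‖

/-- A vector `(p u + q v) / c` with `p q ≠ 0` is never a multiple of `u` or of `v`, because `det u v
≠ 0`; so it must stay out of the ball. If `p = 0` or `q = 0`, the congruence makes it a Gaussian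
multiple of `v` or `u`, and only unit multiples fit in the ball. -/
theorem isAssociated_iff_admissible {L : Submodule GaussianInt (ℂ × ℂ)} {c : GaussianInt}
    {r : ℝ} {e f w₁ w₂ : ℂ} (hc : c ≠ 0) (hr : 0 < r) (he : ‖e‖ = 1) (hf : ‖f‖ = 1)
    (hw₁ : ‖w₁‖ < 1) (hw₂ : ‖w₂‖ < 1)
    (hdet : det (r • (e, f * w₂)) (r • (e * w₁, f)) ≠ 0)
    (hL : ∀ z, z ∈ L ↔ ∃ p q : GaussianInt, c ∣ p - q ∧
      c • z = p • (r • (e, f * w₂)) + q • (r • (e * w₁, f))) :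
    IsAssociated L (r • (e, f * w₂)) (r • (e * w₁, f)) ↔ Admissible c w₁ w₂ := by
  have hc' : (c : ℂ) ≠ 0 := mt GaussianInt.toComplex_eq_zero.1 hc
  have hc0 : 0 < ‖(c : ℂ)‖ := norm_pos_iff.2 hc'
  have comb : ∀ p q : GaussianInt, p • (r • (e, f * w₂)) + q • (r • (e * w₁, f)) =
      ((r : ℂ) * e * (p + q * w₁), (r : ℂ) * f * (p * w₂ + q)) := by
    intro p q
    ext <;> simp [smul_eq_toComplex_mul] <;> ring
  have ball : ∀ (p q : GaussianInt) (z : ℂ × ℂ),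
      c • z = p • (r • (e, f * w₂)) + q • (r • (e * w₁, f)) →
      (z ∈ Metric.closedBall 0 r ↔ ‖(p : ℂ) + q * w₁‖ ≤ ‖(c : ℂ)‖ ∧
        ‖(p : ℂ) * w₂ + q‖ ≤ ‖(c : ℂ)‖) := by
    intro p q z hz
    rw [comb, smul_prod_eq, Prod.mk.injEq] at hz
    have h1 := congrArg norm hz.1
    have h2 := congrArg norm hz.2
    simp only [norm_mul, Complex.norm_real, Real.norm_of_nonneg hr.le, he, hf, mul_one] at h1 h2
    rw [mem_closedBall_zero_iff, Prod.norm_def, max_le_iff]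
    refine and_congr ?_ ?_
    · rw [← mul_le_mul_iff_right₀ hc0, h1, mul_comm, mul_le_mul_iff_left₀ hr]
    · rw [← mul_le_mul_iff_right₀ hc0, h2, mul_comm, mul_le_mul_iff_left₀ hr]
  set u : ℂ × ℂ := r • (e, f * w₂) with hu
  set v : ℂ × ℂ := r • (e * w₁, f) with hv
  have nu1 : ‖u.1‖ = r := by simp [hu, he, abs_of_pos hr]
  have nv2 : ‖v.2‖ = r := by simp [hv, hf, abs_of_pos hr]
  have nu2 : ‖u.2‖ < r := by
    simp only [hu, Prod.smul_mk, norm_smul, Real.norm_of_nonneg hr.le, norm_mul, hf, one_mul]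
    nlinarith
  have nv1 : ‖v.1‖ < r := by
    simp only [hv, Prod.smul_mk, norm_smul, Real.norm_of_nonneg hr.le, norm_mul, he, one_mul]
    nlinarith
  have huL : u ∈ L := (hL u).2 ⟨c, 0, by simp, by simp⟩
  have hvL : v ∈ L := (hL v).2 ⟨0, c, by simp, by simp⟩
  constructor
  · rintro ⟨-, -, s, hs, -, -, -, H⟩ p q hp hq hpq
    have hsr : s = r := hs.symm.trans nu1
    subst hsr
    by_contra! hcon
    have hz : c • ((c : ℂ)⁻¹ • (p • u + q • v)) = p • u + q • v := by
      ext <;> simp [smul_eq_toComplex_mul, smul_prod_eq] <;> field_simp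
    have hpv := det_smul_add_left u v p q
    have hqu := det_smul_add_right u v p q
    have hp' : (p : ℂ) ≠ 0 := mt GaussianInt.toComplex_eq_zero.1 hp
    have hq' : (q : ℂ) ≠ 0 := mt GaussianInt.toComplex_eq_zero.1 hq
    have z0 : (c : ℂ)⁻¹ • (p • u + q • v) ≠ 0 := by
      intro h0
      have h1 : p • u + q • v = 0 := by rw [← hz, h0, smul_zero]
      rw [h1] at hpv
      simp only [det, Prod.fst_zero, Prod.snd_zero, zero_mul, sub_self] at hpv
      exact mul_ne_zero hp' hdet hpv.symm
    obtain ⟨ω, -, h | h⟩ := H _ ((hL _).2 ⟨p, q, hpq, hz⟩) z0 ((ball p q _ hz).2 hcon)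
    · have h1 : p • u + q • v = (c * ω : ℂ) • u := by
        rw [← hz, h]; ext <;> simp [smul_eq_toComplex_mul] <;> ring
      rw [h1] at hqu
      refine mul_ne_zero hq' hdet (hqu.symm.trans ?_)
      simp [det]; ring
    · have h1 : p • u + q • v = (c * ω : ℂ) • v := by
        rw [← hz, h]; ext <;> simp [smul_eq_toComplex_mul] <;> ring
      rw [h1] at hpv
      refine mul_ne_zero hp' hdet (hpv.symm.trans ?_)
      simp [det]; ring
  · intro H
    refine ⟨huL, hvL, r, nu1, nv2, nu2, nv1, fun z hz z0 hzr => ?_⟩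
    obtain ⟨p, q, hpq, hcz⟩ := (hL z).1 hz
    have hzr' := (ball p q z hcz).1 hzr
    by_cases hp : p = 0
    · subst hp
      obtain ⟨a, rfl⟩ : c ∣ q := by simpa using hpq
      have hza : z = a • v :=
        gaussianInt_smul_left_cancel hc (by rw [hcz, zero_smul, zero_add, mul_smul])
      have ha : a ≠ 0 := by rintro rfl; simp at hza; exact z0 hza
      refine ⟨a, toComplex_pow_four ha ?_, Or.inr ?_⟩
      · have := hzr'.2
        simp only [map_zero, zero_mul, zero_add, map_mul, norm_mul] at this
        exact (mul_le_iff_le_one_right hc0).1 this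
      · rw [hza]; rfl
    · by_cases hq : q = 0
      · subst hq
        obtain ⟨a, rfl⟩ : c ∣ p := by simpa using hpq
        have hza : z = a • u :=
        gaussianInt_smul_left_cancel hc (by rw [hcz, zero_smul, add_zero, mul_smul])
        have ha : a ≠ 0 := by rintro rfl; simp at hza; exact z0 hza
        refine ⟨a, toComplex_pow_four ha ?_, Or.inl ?_⟩
        · have := hzr'.1
          simp only [map_zero, zero_mul, add_zero, map_mul, norm_mul] at this
          exact (mul_le_iff_le_one_right hc0).1 this
        · rw [hza]; rfl
      · rcases H p q hp hq hpq with h | h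
        · exact absurd hzr'.1 h.not_ge
        · exact absurd hzr'.2 h.not_ge

/-! ### The finite verification -/

set_option maxHeartbeats 10000000 in
/-- In real coordinates `w₁ = x + iy`, `w₂ = s + it`: no short vector `p u + q v` of the lattice
spanned by `(1, w₂)` and `(w₁, 1)` has norm at most `1`, up to the bounds on `p` and `q`. -/
theorem false_of_small_one (x y s t M N : ℝ) (hM : M = x^2+y^2) (hN : N = s^2+t^2)
    (hy : 0 ≤ y) (hyx : y ≤ x) (hM1 : M < 1) (hN1 : N < 1) (hM0 : 0 < M)
    (hD1 : 0 < N - 2*s) (hD2 : 0 < N - 2*s + 2*t + 1)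
    (hA : 0 < N + 2*t ∨ 0 < M - 2*y)
    (hB : 0 < N - 2*s - 2*t + 1 ∨ 0 < M - x + y)
    (hC : 0 < N - s + t ∨ 0 < M - 2*x - 2*y + 1)
    (p₁ p₂ q₁ q₂ : ℤ) (hp₁ : 0 < p₁) (hp₂ : 0 ≤ p₂) (hp : p₁^2+p₂^2 < 8) (hq : q₁^2+q₂^2 < 8)
    (hq0 : ¬ (q₁ = 0 ∧ q₂ = 0))
    (h₁ : (p₁^2+p₂^2 : ℝ) + (q₁^2+q₂^2) * M + 2*((p₁*q₁+p₂*q₂)*x + (p₂*q₁-p₁*q₂)*y) ≤ 1)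
    (h₂ : (q₁^2+q₂^2 : ℝ) + (p₁^2+p₂^2) * N + 2*((p₁*q₁+p₂*q₂)*s + (p₁*q₂-p₂*q₁)*t) ≤ 1) :
    False := by
  have a1 : p₁ ≤ 2 := by nlinarith
  have a2 : p₂ ≤ 2 := by nlinarith
  have a3 : q₁ ≤ 2 := by nlinarith
  have a4 : q₂ ≤ 2 := by nlinarith
  have a5 : -2 ≤ q₁ := by nlinarith
  have a6 : -2 ≤ q₂ := by nlinarith
  have b1 : x ≤ 1 := by nlinarith
  -- Here and in `b10`, `b11` below, `3/2` is a rational substitute for `√2`.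
  have b2 : x + y ≤ 3/2 := by nlinarith [sq_nonneg (x-y)]
  have b3 : -1 ≤ s := by nlinarith
  have b4 : s ≤ 1/2 := by nlinarith
  have b5 : t ≤ 1 := by nlinarith
  have b6 : -1 ≤ t := by nlinarith
  have b7 : 0 < x := by nlinarith
  have b8 : M ≤ x+y := by nlinarith
  have b9 : 0 ≤ N := by nlinarith
  have b10 : -s-t ≤ 3/2 := by nlinarith [sq_nonneg (s-t)]
  have b11 : -s+t ≤ 3/2 := by nlinarith [sq_nonneg (s+t)]
  -- `c2`, `c4`, `c5` bound `M` below linearly, through `|w₁ - a|² ≥ 0` for `a = 1, 1/5, 3/5`; `c3`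
  -- is `|w₂ + i|² > 0`. The fifths match centers `-p/q` with `|q|² = 5`, such as `(1 - 3i)/5` and
  -- `(3 - 4i)/5`.
  have c2 : 0 < M - 2*x + 1 := by nlinarith [sq_nonneg y]
  have c3 : 0 < N + 2*t + 1 := by nlinarith [sq_nonneg (s-t), sq_nonneg s]
  have c4 : 0 ≤ M - 2/5*x + 1/25 := by nlinarith [sq_nonneg (x-1/5), sq_nonneg y]
  have c5 : 0 ≤ M - 6/5*x + 9/25 := by nlinarith [sq_nonneg (x-3/5), sq_nonneg y]
  -- From here on `M` and `N` are independent unknowns, and for fixed `p`, `q` every hypothesis is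
  -- linear.
  clear hM hN
  interval_cases p₁ <;> interval_cases p₂ <;> try (exfalso; revert hp; norm_num; done)
  all_goals clear hp
  all_goals interval_cases q₁ <;> interval_cases q₂ <;> first
    | (exfalso; revert hq; norm_num; done)
    | (exfalso; revert hq0; norm_num; done)
    | skip
  all_goals clear hq hq0
  all_goals norm_num at h₁ h₂
  all_goals try linarith
  all_goals first
    | (rcases hA with hA | hA <;> linarith)
    | (rcases hB with hB | hB <;> linarith)
    | (rcases hC with hC | hC <;> linarith)

set_option maxHeartbeats 10000000 in
/-- The analogue of `false_of_small_one` for the vectors `(p u + q v) / (1 + i)`. -/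
theorem false_of_small_two (x y s t M N : ℝ) (hM : M = x^2+y^2) (hN : N = s^2+t^2)
    (hy : 0 ≤ y) (hyx : y ≤ x) (hM1 : M < 1) (hN1 : N < 1)
    (hM2 : 1 < M + 2*y) (hN2 : 1 < N - 2*s) (hN3 : 1 < N + 2*t)
    (p₁ p₂ q₁ q₂ : ℤ) (hp₁ : 0 < p₁) (hp₂ : 0 ≤ p₂) (hp : p₁^2+p₂^2 < 8) (hq : q₁^2+q₂^2 < 8)
    (hq0 : ¬ (q₁ = 0 ∧ q₂ = 0)) (hpq : (p₁ + p₂ + q₁ + q₂) % 2 = 0)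
    (h₁ : (p₁^2+p₂^2 : ℝ) + (q₁^2+q₂^2) * M + 2*((p₁*q₁+p₂*q₂)*x + (p₂*q₁-p₁*q₂)*y) ≤ 2)
    (h₂ : (q₁^2+q₂^2 : ℝ) + (p₁^2+p₂^2) * N + 2*((p₁*q₁+p₂*q₂)*s + (p₁*q₂-p₂*q₁)*t) ≤ 2) :
    False := by
  have b1 : x ≤ 1 := by nlinarith
  have b2 : x + y ≤ 3/2 := by nlinarith [sq_nonneg (x-y)]
  have b3 : -1 ≤ s := by nlinarith
  have b5 : t ≤ 1 := by nlinarith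
  have b11 : -s+t ≤ 3/2 := by nlinarith [sq_nonneg (s+t)]
  have c2 : 0 < M - 2*x + 1 := by nlinarith [sq_nonneg y]
  have a1 : p₁ ≤ 2 := by nlinarith
  have a2 : p₂ ≤ 2 := by nlinarith
  have a3 : q₁ ≤ 2 := by nlinarith
  have a4 : q₂ ≤ 2 := by nlinarith
  have a5 : -2 ≤ q₁ := by nlinarith
  have a6 : -2 ≤ q₂ := by nlinarith
  clear hM hN
  interval_cases p₁ <;> interval_cases p₂ <;> try (exfalso; revert hp; norm_num; done)
  all_goals clear hp
  all_goals interval_cases q₁ <;> interval_cases q₂ <;> first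
    | (exfalso; revert hq; norm_num; done)
    | (exfalso; revert hq0; norm_num; done)
    | (exfalso; revert hpq; norm_num; done)
    | skip
  all_goals clear hq hq0 hpq
  all_goals norm_num at h₁ h₂
  all_goals linarith

/-! ### Symmetries -/

/-- The unit `α` is absorbed into `q`. Since `c` divides `1 - i`, it divides `1 - g` for every unit
`g`, so the congruence `p ≡ q` survives the change from `q` to `g q`. -/
theorem Admissible.rotate {c : GaussianInt} (hc : c ∣ 1 - ⟨0, 1⟩) {w₁ w₂ : ℂ}
    (h : Admissible c w₁ w₂) {α : ℂ} (hα : α ^ 4 = 1) : Admissible c (α * w₁) (α⁻¹ * w₂) := by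
  have α0 : α ≠ 0 := by rintro rfl; simp at hα
  obtain ⟨g, hg, hgc⟩ : ∃ g : GaussianInt, (g : ℂ) = α ∧ c ∣ 1 - g := by
    have h2 : c ∣ 2 := hc.trans ⟨⟨1, 1⟩, by decide⟩
    rcases eq_of_pow_four hα with rfl | rfl | rfl | rfl
    · exact ⟨1, by simp, by simp⟩
    · exact ⟨-1, by simp, by norm_num; exact h2⟩
    · exact ⟨⟨0, 1⟩, by simp [GaussianInt.toComplex_def], hc⟩
    · exact ⟨⟨0, -1⟩, by simp [GaussianInt.toComplex_def], hc.trans ⟨⟨0, 1⟩, by decide⟩⟩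
  have g0 : g ≠ 0 := by rintro rfl; simp at hg; exact α0 hg.symm
  intro p q hp hq hpq
  have e : p - g * q = p - q + (1 - g) * q := by ring
  rcases h p (g * q) hp (mul_ne_zero g0 hq)
    (by rw [e]; exact dvd_add hpq (hgc.mul_right q)) with h | h
  · left
    rw [map_mul, hg] at h
    convert h using 3
    ring
  · right
    rw [map_mul, hg] at h
    refine h.trans_eq ?_
    rw [← one_mul ‖_ * (α⁻¹ * w₂) + _‖, ← norm_eq_one_of_pow_four hα, ← norm_mul]
    congr 1
    field_simp

theorem Admissible.conj {c : GaussianInt} (hc : c ∣ star c) {w₁ w₂ : ℂ}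
    (h : Admissible c w₁ w₂) :
    Admissible c (starRingEnd ℂ w₁) (starRingEnd ℂ w₂) := by
  intro p q hp hq hpq
  have hpq' : c ∣ star p - star q := by
    obtain ⟨d, hd⟩ := hpq
    rw [← star_sub, hd, star_mul']
    exact hc.mul_right _
  have e1 : ‖(p : ℂ) + q * starRingEnd ℂ w₁‖ = ‖((star p : GaussianInt) : ℂ) +
      (star q : GaussianInt) * w₁‖ := by
    rw [← RCLike.norm_conj]; simp [GaussianInt.toComplex_star]
  have e2 : ‖(p : ℂ) * starRingEnd ℂ w₂ + q‖ = ‖((star p : GaussianInt) : ℂ) * w₂ +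
      (star q : GaussianInt)‖ := by
    rw [← RCLike.norm_conj]; simp [GaussianInt.toComplex_star]
  rw [e1, e2]
  exact h _ _ (star_ne_zero.2 hp) (star_ne_zero.2 hq) hpq'

theorem exists_of_mem_D₈ {φ : ℂ ≃ₗᵢ[ℝ] ℂ} (h : φ ∈ D₈) :
    ∃ α : ℂ, α ^ 4 = 1 ∧ ((∀ z, φ z = α * z) ∨ ∀ z, φ z = α * starRingEnd ℂ z) := by
  induction h using Subgroup.closure_induction with
  | mem φ hφ =>
    rcases hφ with ⟨α, hα, h⟩ | h
    · exact ⟨α, hα, Or.inl h⟩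
    · rw [Set.mem_singleton_iff] at h
      subst h
      exact ⟨1, by simp, Or.inr fun z => by simp⟩
  | one => exact ⟨1, by simp, Or.inl fun z => by simp⟩
  | mul φ ψ _ _ h₁ h₂ =>
    obtain ⟨α, hα, h₁⟩ := h₁
    obtain ⟨β, hβ, h₂⟩ := h₂
    rcases h₁ with h₁ | h₁
    · refine ⟨α * β, by rw [mul_pow, hα, hβ, one_mul], ?_⟩
      rcases h₂ with h₂ | h₂
      · left; intro z; simp [h₁, h₂, mul_assoc]
      · right; intro z; simp [h₁, h₂, mul_assoc]
    · refine ⟨α * starRingEnd ℂ β, by rw [mul_pow, ← map_pow, hα, hβ]; simp, ?_⟩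
      rcases h₂ with h₂ | h₂
      · right; intro z; simp [h₁, h₂, mul_assoc]
      · left; intro z; simp [h₁, h₂, mul_assoc]
  | inv φ _ h =>
    obtain ⟨α, hα, h⟩ := h
    have α0 : α ≠ 0 := by rintro rfl; simp at hα
    rcases h with h | h
    · refine ⟨α⁻¹, by rw [inv_pow, hα, inv_one], Or.inl fun z => φ.injective ?_⟩
      refine (φ.apply_symm_apply z).trans ?_
      rw [h, mul_inv_cancel_left₀ α0]
    · refine ⟨α, hα, Or.inr fun z => φ.injective ?_⟩
      refine (φ.apply_symm_apply z).trans ?_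
      rw [h, map_mul (starRingEnd ℂ), Complex.conj_conj, ← mul_assoc, Complex.mul_conj,
        Complex.normSq_eq_norm_sq, norm_eq_one_of_pow_four hα]
      simp only [one_pow, Complex.ofReal_one, one_mul]

theorem exists_mem_D₈_mul {α : ℂ} (hα : α ^ 4 = 1) : ∃ φ ∈ D₈, ∀ z, φ z = α * z := by
  let a : Circle := ⟨α, mem_sphere_zero_iff_norm.2 (norm_eq_one_of_pow_four hα)⟩
  have h : ∀ z, rotation a z = α * z := fun z => rotation_apply a z
  exact ⟨rotation a, Subgroup.subset_closure (Or.inl ⟨α, hα, h⟩), h⟩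

theorem conj_eq_inv_of_pow_four {α : ℂ} (hα : α ^ 4 = 1) : starRingEnd ℂ α = α⁻¹ := by
  rw [Complex.inv_def, Complex.normSq_eq_norm_sq, norm_eq_one_of_pow_four hα]; simp

/-- Each `φ` is `z ↦ α z` or `z ↦ α z̄` with `α = φ 1`, and `α w₂ / α² = α⁻¹ w₂`. As `ᾱ = α⁻¹`, the
conjugate-linear action is an involution, which is why its inverse uses the same `α`. -/
theorem mem_orbit_iff {W : Set (ℂ × ℂ)} {w₁ w₂ : ℂ} :
    (w₁, w₂) ∈ orbit W ↔ ∃ α : ℂ, α ^ 4 = 1 ∧ ((α * w₁, α⁻¹ * w₂) ∈ W ∨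
      (α * starRingEnd ℂ w₁, α⁻¹ * starRingEnd ℂ w₂) ∈ W) := by
  constructor
  · rintro ⟨φ, hφ, w, hw, h⟩
    rw [Prod.mk.injEq] at h
    obtain ⟨rfl, rfl⟩ := h
    obtain ⟨α, hα, h⟩ := exists_of_mem_D₈ hφ
    have α0 : α ≠ 0 := by rintro rfl; simp at hα
    rcases h with h | h
    · refine ⟨α⁻¹, by rw [inv_pow, hα, inv_one], Or.inl ?_⟩
      rw [h, h, h]
      convert hw using 1
      ext1
      · simp [α0]
      · simp only [mul_one, inv_inv]; field_simp
    · refine ⟨α, hα, Or.inr ?_⟩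
      rw [h, h, h]
      convert hw using 1
      ext1
      · simp [conj_eq_inv_of_pow_four hα, α0]
      · simp [conj_eq_inv_of_pow_four hα]; field_simp
  · rintro ⟨α, hα, h⟩
    have α0 : α ≠ 0 := by rintro rfl; simp at hα
    rcases h with h | h
    · obtain ⟨φ, hφ, hφα⟩ := exists_mem_D₈_mul (α := α⁻¹) (by rw [inv_pow, hα, inv_one])
      refine ⟨φ, hφ, _, h, ?_⟩
      simp only [hφα]
      ext1
      · simp [α0]
      · simp only [mul_one]; field_simp
    · obtain ⟨φ, hφ, hφα⟩ := exists_mem_D₈_mul hα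
      have hmem : Complex.conjLIE ∈ D₈ := Subgroup.subset_closure (Or.inr rfl)
      have hval : ∀ z, (φ * Complex.conjLIE) z = α * starRingEnd ℂ z := fun z => by
        rw [LinearIsometryEquiv.coe_mul, Function.comp_apply, hφα, Complex.conjLIE_apply]
      refine ⟨φ * Complex.conjLIE, D₈.mul_mem hφ hmem, _, h, ?_⟩
      simp only [hval]
      ext1
      · simp [conj_eq_inv_of_pow_four hα, α0]
      · simp [conj_eq_inv_of_pow_four hα]; field_simp

/-- The upper bound on the argument is read off from the sign of `|z| √2 sin (arg z - π/4) = Im z -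
Re z`. -/
theorem arg_mem_Icc_iff {z : ℂ} :
    Complex.arg z ∈ Set.Icc 0 (Real.pi / 4) ↔ 0 ≤ z.im ∧ z.im ≤ z.re := by
  rw [Set.mem_Icc, Complex.arg_nonneg_iff]
  refine and_congr_right fun h => ?_
  have h0 : 0 ≤ z.arg := Complex.arg_nonneg_iff.2 h
  have hpi := Complex.arg_le_pi z
  have hc := Complex.norm_mul_cos_arg z
  have hs := Complex.norm_mul_sin_arg z
  have key : ‖z‖ * √2 * Real.sin (z.arg - Real.pi / 4) = z.im - z.re := by
    rw [Real.sin_sub, Real.cos_pi_div_four, Real.sin_pi_div_four]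
    have h2 : √2 * √2 = 2 := Real.mul_self_sqrt zero_le_two
    linear_combination (‖z‖ * (z.arg.sin - z.arg.cos) / 2) * h2 + hs - hc
  constructor
  · intro h4
    have : Real.sin (z.arg - Real.pi / 4) ≤ 0 :=
      Real.sin_nonpos_of_nonpos_of_neg_pi_le (by linarith) (by linarith)
    have h5 : ‖z‖ * √2 * Real.sin (z.arg - Real.pi / 4) ≤ 0 :=
      mul_nonpos_of_nonneg_of_nonpos (by positivity) this
    linarith
  · intro h4
    by_contra! h5
    have z0 : z ≠ 0 := by rintro rfl; simp at h5; linarith [Real.pi_pos]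
    have : 0 < Real.sin (z.arg - Real.pi / 4) :=
      Real.sin_pos_of_pos_of_lt_pi (by linarith) (by linarith [Real.pi_pos])
    have h6 : 0 < ‖z‖ * √2 * Real.sin (z.arg - Real.pi / 4) := by
      have := norm_pos_iff.2 z0
      positivity
    linarith

theorem exists_rotation_mem_sector (z : ℂ) : ∃ α : ℂ, α ^ 4 = 1 ∧
    ((0 ≤ (α * z).im ∧ (α * z).im ≤ (α * z).re) ∨
      (0 ≤ (α * starRingEnd ℂ z).im ∧ (α * starRingEnd ℂ z).im ≤ (α * starRingEnd ℂ z).re)) := by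
  have hI : Complex.I ^ 4 = 1 := Complex.I_pow_four
  rcases le_total 0 z.re with h1 | h1 <;> rcases le_total 0 z.im with h2 | h2 <;>
    rcases le_total |z.re| |z.im| with h3 | h3 <;>
    simp only [abs_of_nonneg, abs_of_nonpos, h1, h2] at h3
  · exact ⟨Complex.I, hI, Or.inr (by simp; constructor <;> linarith)⟩
  · exact ⟨1, by simp, Or.inl (by simp; constructor <;> linarith)⟩
  · exact ⟨Complex.I, hI, Or.inl (by simp; constructor <;> linarith)⟩
  · exact ⟨1, by simp, Or.inr (by simp; constructor <;> linarith)⟩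
  · exact ⟨-Complex.I, by rw [neg_pow, hI]; norm_num, Or.inl (by simp; constructor <;> linarith)⟩
  · exact ⟨-1, by norm_num, Or.inr (by simp; constructor <;> linarith)⟩
  · exact ⟨-Complex.I, by rw [neg_pow, hI]; norm_num, Or.inr (by simp; constructor <;> linarith)⟩
  · exact ⟨-1, by norm_num, Or.inl (by simp; constructor <;> linarith)⟩

/-- A description of admissible pairs over the sector extends to the whole bidisk by symmetry. -/
theorem admissible_iff_mem_orbit {c : GaussianInt} (hc : c ∣ 1 - ⟨0, 1⟩) (hc' : c ∣ star c)
    {W : Set (ℂ × ℂ)} (hW : ∀ w ∈ W, w.1 ∈ sectorC ∧ ‖w.2‖ < 1)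
    (H : ∀ w₁ ∈ sectorC, ∀ w₂ : ℂ, ‖w₂‖ < 1 → (Admissible c w₁ w₂ ↔ (w₁, w₂) ∈ W))
    {w₁ w₂ : ℂ} (hw₁ : ‖w₁‖ < 1) (hw₂ : ‖w₂‖ < 1) :
    Admissible c w₁ w₂ ↔ (w₁, w₂) ∈ orbit W := by
  have mem : ∀ w, w ∈ W → Admissible c w.1 w.2 := fun w hw =>
    (H _ (hW w hw).1 _ (hW w hw).2).2 hw
  have back : ∀ {α z₁ z₂ : ℂ}, α ^ 4 = 1 → Admissible c (α * z₁) (α⁻¹ * z₂) →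
      Admissible c z₁ z₂ := by
    intro α z₁ z₂ hα h
    have α0 : α ≠ 0 := by rintro rfl; simp at hα
    simpa [α0] using h.rotate hc (α := α⁻¹) (by rw [inv_pow, hα, inv_one])
  rw [mem_orbit_iff]
  constructor
  · intro h
    obtain ⟨α, hα, hz⟩ := exists_rotation_mem_sector w₁
    have nα := norm_eq_one_of_pow_four hα
    refine ⟨α, hα, hz.imp (fun hz => ?_) fun hz => ?_⟩
    · exact (H _ ⟨by simpa [nα] using hw₁, arg_mem_Icc_iff.2 hz⟩ _ (by simpa [nα] using hw₂)).1
        (h.rotate hc hα)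
    · exact (H _ ⟨by simpa [nα] using hw₁, arg_mem_Icc_iff.2 hz⟩ _ (by simpa [nα] using hw₂)).1
        ((h.conj hc').rotate hc hα)
  · rintro ⟨α, hα, h | h⟩
    · exact back hα (mem _ h)
    · simpa using (back hα (mem _ h)).conj hc'

/-! ### Admissible pairs over the sector -/

theorem sq_norm_add_mul (p q : GaussianInt) (w : ℂ) :
    ‖(p : ℂ) + q * w‖ ^ 2 = ((p.re : ℝ) ^ 2 + (p.im : ℝ) ^ 2) +
      ((q.re : ℝ) ^ 2 + (q.im : ℝ) ^ 2) * (w.re ^ 2 + w.im ^ 2) +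
      2 * ((p.re * q.re + p.im * q.im) * w.re + (p.im * q.re - p.re * q.im) * w.im) := by
  rw [Complex.sq_norm, Complex.normSq_apply]
  simp
  ring

theorem sq_norm_mul_add (p q : GaussianInt) (w : ℂ) :
    ‖(p : ℂ) * w + q‖ ^ 2 = ((q.re : ℝ) ^ 2 + (q.im : ℝ) ^ 2) +
      ((p.re : ℝ) ^ 2 + (p.im : ℝ) ^ 2) * (w.re ^ 2 + w.im ^ 2) +
      2 * ((p.re * q.re + p.im * q.im) * w.re + (p.re * q.im - p.im * q.re) * w.im) := by
  rw [add_comm, sq_norm_add_mul]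
  ring

theorem sq_norm_toComplex (p : GaussianInt) :
    ‖(p : ℂ)‖ ^ 2 = (p.re : ℝ) ^ 2 + (p.im : ℝ) ^ 2 := by
  simpa using sq_norm_add_mul p 0 0

theorem sq_norm_eq (w : ℂ) : ‖w‖ ^ 2 = w.re ^ 2 + w.im ^ 2 := by
  rw [Complex.sq_norm, Complex.normSq_apply]; ring

theorem norm_lt_one_iff {w : ℂ} : ‖w‖ < 1 ↔ w.re ^ 2 + w.im ^ 2 < 1 := by
  rw [← sq_norm_eq, sq_lt_one_iff₀ (norm_nonneg w)]

theorem lt_dist_iff {w a : ℂ} {r : ℝ} (hr : 0 ≤ r) :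
    r < dist w a ↔ r ^ 2 < (w.re - a.re) ^ 2 + (w.im - a.im) ^ 2 := by
  rw [dist_eq_norm, ← Complex.sub_re, ← Complex.sub_im, ← sq_norm_eq,
    sq_lt_sq₀ hr (norm_nonneg _)]

theorem Admissible.sq_lt {c : GaussianInt} {w₁ w₂ : ℂ} (h : Admissible c w₁ w₂)
    (p q : GaussianInt) (hp : p ≠ 0) (hq : q ≠ 0) (hpq : c ∣ p - q) :
    (c.re : ℝ) ^ 2 + (c.im : ℝ) ^ 2 < ((p.re : ℝ) ^ 2 + (p.im : ℝ) ^ 2) +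
        ((q.re : ℝ) ^ 2 + (q.im : ℝ) ^ 2) * (w₁.re ^ 2 + w₁.im ^ 2) +
        2 * ((p.re * q.re + p.im * q.im) * w₁.re + (p.im * q.re - p.re * q.im) * w₁.im) ∨
      (c.re : ℝ) ^ 2 + (c.im : ℝ) ^ 2 < ((q.re : ℝ) ^ 2 + (q.im : ℝ) ^ 2) +
        ((p.re : ℝ) ^ 2 + (p.im : ℝ) ^ 2) * (w₂.re ^ 2 + w₂.im ^ 2) +
        2 * ((p.re * q.re + p.im * q.im) * w₂.re + (p.re * q.im - p.im * q.re) * w₂.im) := by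
  rw [← sq_norm_add_mul, ← sq_norm_mul_add, ← sq_norm_toComplex,
    sq_lt_sq₀ (norm_nonneg _) (norm_nonneg _), sq_lt_sq₀ (norm_nonneg _) (norm_nonneg _)]
  exact h p q hp hq hpq

theorem exists_unit_mul_first_quadrant {p : GaussianInt} (hp : p ≠ 0) :
    ∃ ε : GaussianInt, ε ≠ 0 ∧ ‖(ε : ℂ)‖ = 1 ∧ 0 < (ε * p).re ∧ 0 ≤ (ε * p).im := by
  obtain ⟨m, n⟩ := p
  have h0 : ¬ (m = 0 ∧ n = 0) := by rintro ⟨rfl, rfl⟩; exact hp rfl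
  have norm_unit : ∀ ε : GaussianInt, ε ^ 4 = 1 → ‖(ε : ℂ)‖ = 1 := fun ε h =>
    norm_eq_one_of_pow_four (by rw [← map_pow, h, map_one])
  have key : (0 < m ∧ 0 ≤ n) ∨ (0 < n ∧ m ≤ 0) ∨ (m < 0 ∧ n ≤ 0) ∨ (n < 0 ∧ 0 ≤ m) := by omega
  rcases key with h | h | h | h
  · exact ⟨1, by decide, norm_unit _ (by decide), by simpa using h.1, by simpa using h.2⟩
  · exact ⟨⟨0, -1⟩, by decide, norm_unit _ (by decide), by simpa using h.1, by simpa using h.2⟩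
  · exact ⟨-1, by decide, norm_unit _ (by decide), by simpa using h.1, by simpa using h.2⟩
  · exact ⟨⟨0, 1⟩, by decide, norm_unit _ (by decide), by simpa using h.1, by simpa using h.2⟩

/-- A lower bound for `|1 - w₁w₂|` reduces admissibility to finitely many conditions. -/
theorem admissible_of_first_quadrant {c : GaussianInt} {w₁ w₂ : ℂ} (hc : c ≠ 0)
    (hw₁ : ‖w₁‖ < 1) (hw₂ : ‖w₂‖ < 1) (h : ‖(c : ℂ)‖ ^ 2 ≤ 2 * ‖1 - w₁ * w₂‖ ^ 2)
    (H : ∀ p q : GaussianInt, 0 < p.re → 0 ≤ p.im → p.re ^ 2 + p.im ^ 2 < 8 →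
      q.re ^ 2 + q.im ^ 2 < 8 → ¬ (q.re = 0 ∧ q.im = 0) → c ∣ p - q →
      ‖(p : ℂ) + q * w₁‖ ^ 2 ≤ ‖(c : ℂ)‖ ^ 2 → ‖(p : ℂ) * w₂ + q‖ ^ 2 ≤ ‖(c : ℂ)‖ ^ 2 → False) :
    Admissible c w₁ w₂ := by
  intro p q hp hq hpq
  by_contra! hcon
  obtain ⟨h₁, h₂⟩ := hcon
  have hc0 : 0 < ‖(c : ℂ)‖ := by linarith [one_le_norm_toComplex hc]
  obtain ⟨ε, ε0, hε, hre, him⟩ := exists_unit_mul_first_quadrant hp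
  -- Eliminating one of the two unknowns, as in `p (1 - w₁w₂) = (p + q w₁) - w₁ (p w₂ + q)`, gives
  -- `|a| |1 - w₁w₂| < 2 |c|` for `a = p, q`. Squaring and using `|c|² ≤ 2 |1 - w₁w₂|²` produces the
  -- constant 8.
  have bound : ∀ (a : GaussianInt) (z w : ℂ), ‖w‖ < 1 → ‖z‖ ≤ ‖(c : ℂ)‖ →
      ‖(a : ℂ) * (1 - w₁ * w₂)‖ ≤ ‖z‖ + ‖w‖ * ‖(c : ℂ)‖ → (ε * a).re ^ 2 + (ε * a).im ^ 2 < 8 := by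
    intro a z w hw hz ha
    have h3 : ‖(a : ℂ)‖ * ‖1 - w₁ * w₂‖ < 2 * ‖(c : ℂ)‖ := by
      rw [← norm_mul]; nlinarith
    have h4 : (‖(a : ℂ)‖ * ‖1 - w₁ * w₂‖) ^ 2 < (2 * ‖(c : ℂ)‖) ^ 2 :=
      pow_lt_pow_left₀ h3 (by positivity) two_ne_zero
    have h5 : ‖((ε * a : GaussianInt) : ℂ)‖ ^ 2 < 8 := by
      rw [map_mul, norm_mul, hε, one_mul]
      by_contra! h6
      nlinarith [sq_nonneg ‖1 - w₁ * w₂‖]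
    rw [sq_norm_toComplex] at h5
    exact_mod_cast h5
  have hp8 : (ε * p).re ^ 2 + (ε * p).im ^ 2 < 8 := by
    refine bound p (p + q * w₁) w₁ hw₁ h₁ ?_
    have e : (p : ℂ) * (1 - w₁ * w₂) = (p + q * w₁) - w₁ * (p * w₂ + q) := by ring
    rw [e]
    refine (norm_sub_le _ _).trans ?_
    rw [norm_mul]
    gcongr
  have hq8 : (ε * q).re ^ 2 + (ε * q).im ^ 2 < 8 := by
    refine bound q (p * w₂ + q) w₂ hw₂ h₂ ?_
    have e : (q : ℂ) * (1 - w₁ * w₂) = (p * w₂ + q) - w₂ * (p + q * w₁) := by ring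
    rw [e]
    refine (norm_sub_le _ _).trans ?_
    rw [norm_mul]
    gcongr
  refine H (ε * p) (ε * q) hre him hp8 hq8 ?_ ?_ ?_ ?_
  · rintro ⟨h3, h4⟩
    exact mul_ne_zero ε0 hq (Zsqrtd.ext h3 h4)
  · rw [← mul_sub]; exact hpq.mul_left _
  · rw [map_mul, map_mul, mul_assoc, ← mul_add, norm_mul, hε, one_mul]
    gcongr
  · rw [map_mul, map_mul, mul_assoc, ← mul_add, norm_mul, hε, one_mul]
    gcongr

/-- Write `w₁w₂ = a + ib`. The point 1 is at distance at least `1/√2` from the half-planes `a ≤ 0`,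
`a ≤ b` and `a ≤ -b`, and one of them contains `w₁w₂` unless `w₂` is in the fourth quadrant. In that
quadrant `w₂` lies in `Red₂`, so `w₁` avoids `Red₁`, and the square is estimated directly. -/
theorem half_le_sq_norm_one_sub (x y s t M N : ℝ) (hM : M = x ^ 2 + y ^ 2)
    (hN : N = s ^ 2 + t ^ 2) (hy : 0 ≤ y) (hyx : y ≤ x) (hM1 : M < 1) (hN1 : N < 1)
    (hD1 : 0 < N - 2 * s) (hD2 : 0 < N - 2 * s + 2 * t + 1)
    (hA : 0 < N + 2 * t ∨ 0 < M - 2 * y) :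
    1 / 2 ≤ (1 - (x * s - y * t)) ^ 2 + (x * t + y * s) ^ 2 := by
  have hx : 0 ≤ x := hy.trans hyx
  have of_nonpos : ∀ a b : ℝ, a ≤ 0 → 1 / 2 ≤ (1 - a) ^ 2 + b ^ 2 := fun a b h => by
    nlinarith [sq_nonneg b]
  have of_le : ∀ a b : ℝ, a ≤ b → 1 / 2 ≤ (1 - a) ^ 2 + b ^ 2 := fun a b h => by
    nlinarith [sq_nonneg (1 - a - b)]
  rcases le_total s 0 with hs | hs <;> rcases le_total 0 t with ht | ht
  · exact of_nonpos _ _ (by nlinarith [mul_nonneg hx (neg_nonneg.2 hs), mul_nonneg hy ht])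
  · have := of_le (x * s - y * t) (-(x * t + y * s))
      (by nlinarith [mul_nonneg hx (neg_nonneg.2 hs), mul_nonneg hy (neg_nonneg.2 hs),
        mul_nonneg (sub_nonneg.2 hyx) (neg_nonneg.2 ht)])
    rwa [neg_sq] at this
  · have hst : s ≤ t := by nlinarith
    refine of_le _ _ ?_
    nlinarith [mul_nonneg hx (sub_nonneg.2 hst), mul_nonneg hy hs, mul_nonneg hy ht]
  · have hst : s ≤ -t := by nlinarith
    have hA' : 0 < M - 2 * y := hA.resolve_left fun h => by nlinarith
    have e : (1 - (x * s - y * t)) ^ 2 + (x * t + y * s) ^ 2 =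
        1 - 2 * (x * s) + 2 * (y * t) + M * N := by rw [hM, hN]; ring
    rw [e]
    clear e of_nonpos of_le hA
    have hM0 : 0 ≤ M := by rw [hM]; positivity
    have hx1 : x * s ≤ s := mul_le_of_le_one_left hs (by nlinarith [sq_nonneg y])
    have hyt : M * t ≤ 2 * (y * t) := by nlinarith
    clear hM hyx hx hy hA'
    have hm : 2 * s - s ^ 2 < t ^ 2 := by linarith
    have hm' : 2 * s - s ^ 2 < (1 + t) ^ 2 := by linarith
    have ht1 : 0 ≤ 1 + t := by nlinarith [sq_nonneg s]
    have hs1 : s ≤ 1 := by nlinarith [sq_nonneg t]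
    clear hD1 hD2 hN1 hst
    -- One of `|t|` and `|1 + t|` is at most `1/2`.
    have hq : 2 * s - s ^ 2 ≤ 1 / 4 := by
      rcases le_total t (-1 / 2) with h | h
      · nlinarith
      · nlinarith
    have hs2 : s ≤ 1 / 4 := by nlinarith
    -- This is the average of the two disk conditions `hm` and `hm'`.
    have hmax : -t - N ≤ 1 / 2 - 2 * s := by linarith [sq_nonneg (t + 1 / 2)]
    have hMN : M * (-t - N) ≤ 1 / 2 - 2 * s := by
      rcases le_total 0 (-t - N) with h | h
      · exact (mul_le_of_le_one_left h hM1.le).trans hmax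
      · exact (mul_nonpos_of_nonneg_of_nonpos hM0 h).trans (by linarith)
    linarith

theorem mem_sectorC_iff {w : ℂ} :
    w ∈ sectorC ↔ w.re ^ 2 + w.im ^ 2 < 1 ∧ 0 ≤ w.im ∧ w.im ≤ w.re := by
  rw [← norm_lt_one_iff, ← arg_mem_Icc_iff]; rfl

theorem mem_regionD_iff {w : ℂ} : w ∈ regionD ↔ w.re ^ 2 + w.im ^ 2 < 1 ∧
    0 < w.re ^ 2 + w.im ^ 2 - 2 * w.re ∧
    0 < w.re ^ 2 + w.im ^ 2 - 2 * w.re + 2 * w.im + 1 := by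
  simp only [regionD, Set.mem_ofPred_eq, lt_dist_iff zero_le_one, norm_lt_one_iff]
  simp
  intro _
  constructor <;> rintro ⟨h1, h2⟩ <;> constructor <;> nlinarith

theorem mem_regionT_iff {w : ℂ} : w ∈ regionT ↔ w.re ^ 2 + w.im ^ 2 < 1 ∧
    1 < w.re ^ 2 + w.im ^ 2 - 2 * w.re ∧ 1 < w.re ^ 2 + w.im ^ 2 + 2 * w.im := by
  simp only [regionT, Set.mem_ofPred_eq, lt_dist_iff (Real.sqrt_nonneg 2), norm_lt_one_iff]
  simp
  intro _
  constructor <;> rintro ⟨h1, h2⟩ <;> constructor <;> nlinarith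

theorem notMem_closedBall_iff {w a : ℂ} {r : ℝ} (hr : 0 ≤ r) :
    w ∉ Metric.closedBall a r ↔ r ^ 2 < (w.re - a.re) ^ 2 + (w.im - a.im) ^ 2 := by
  rw [Metric.mem_closedBall, not_le, lt_dist_iff hr]

theorem notMem_Red₁_iff {w : ℂ} : w ∉ Red₁ ↔ 0 < w.re ^ 2 + w.im ^ 2 - 2 * w.im := by
  rw [Red₁, notMem_closedBall_iff zero_le_one]
  simp
  constructor <;> intro h <;> nlinarith

theorem notMem_Red₂_iff {w : ℂ} : w ∉ Red₂ ↔ 0 < w.re ^ 2 + w.im ^ 2 + 2 * w.im := by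
  rw [Red₂, notMem_closedBall_iff zero_le_one]
  simp
  constructor <;> intro h <;> nlinarith

theorem notMem_Blue₁_iff {w : ℂ} : w ∉ Blue₁ ↔ 0 < w.re ^ 2 + w.im ^ 2 - w.re + w.im := by
  rw [Blue₁, notMem_closedBall_iff (by positivity), div_pow, Real.sq_sqrt zero_le_two]
  simp
  constructor <;> intro h <;> nlinarith

theorem notMem_Blue₂_iff {w : ℂ} :
    w ∉ Blue₂ ↔ 0 < w.re ^ 2 + w.im ^ 2 - 2 * w.re - 2 * w.im + 1 := by
  rw [Blue₂, notMem_closedBall_iff zero_le_one]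
  simp
  constructor <;> intro h <;> nlinarith

/-- The four cases collapse because `Green₂ ∩ 𝒟 ⊆ Red₂`, `Red₂` and `Blue₂` are disjoint, and 0 lies
in both `Red₁` and `Blue₁`. -/
theorem mem_W₁zero_iff {w₁ w₂ : ℂ} : (w₁, w₂) ∈ W₁zero ↔ w₁ ∈ sectorC ∧ w₂ ∈ regionD ∧ w₁ ≠ 0 ∧
    (w₂ ∉ Red₂ ∨ w₁ ∉ Red₁) ∧ (w₂ ∉ Blue₂ ∨ w₁ ∉ Blue₁) ∧ (w₂ ∉ Green₂ ∨ w₁ ∉ Green₁) := by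
  have hGR : w₂ ∈ regionD → w₂ ∈ Green₂ → w₂ ∈ Red₂ := by
    intro hD hG
    by_contra hR
    rw [mem_regionD_iff] at hD
    rw [notMem_Red₂_iff] at hR
    have hG' := not_lt.1 (mt notMem_Blue₁_iff.2 (not_not.2 hG))
    linarith
  have hRB : w₂ ∈ Red₂ → w₂ ∉ Blue₂ := by
    intro hR
    rw [notMem_Blue₂_iff]
    have hR' := not_lt.1 (mt notMem_Red₂_iff.2 (not_not.2 hR))
    nlinarith [sq_nonneg (w₂.re - 1), sq_nonneg w₂.re, sq_nonneg w₂.im, sq_nonneg (w₂.im + 1)]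
  have h0R : w₁ ∉ Red₁ → w₁ ≠ 0 := by rintro h rfl; simp [notMem_Red₁_iff] at h
  have h0B : w₁ ∉ Blue₁ → w₁ ≠ 0 := by rintro h rfl; simp [notMem_Blue₁_iff] at h
  have h0 : w₁ ≠ 0 ∨ (w₁ ∈ Red₁ ∧ w₁ ∈ Blue₁) := by tauto
  simp only [W₁zero, Set.mem_ofPred_eq, Set.mem_union, Set.mem_sdiff]
  by_cases hD : w₂ ∈ regionD <;> by_cases hG : w₂ ∈ Green₂ <;> by_cases hR : w₂ ∈ Red₂ <;>
    by_cases hB : w₂ ∈ Blue₂ <;> simp_all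

theorem admissible_one_iff {w₁ w₂ : ℂ} (hw₁ : w₁ ∈ sectorC) (hw₂ : ‖w₂‖ < 1) :
    Admissible 1 w₁ w₂ ↔ (w₁, w₂) ∈ W₁zero := by
  have hs := mem_sectorC_iff.1 hw₁
  obtain ⟨hM1, hy, hyx⟩ := hs
  have hN1 := norm_lt_one_iff.1 hw₂
  rw [mem_W₁zero_iff, mem_regionD_iff, notMem_Red₁_iff, notMem_Red₂_iff, notMem_Blue₁_iff,
    notMem_Blue₂_iff, show (w₂ ∉ Green₂ ↔ _) from notMem_Blue₁_iff,
    show (w₁ ∉ Green₁ ↔ _) from notMem_Blue₂_iff]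
  constructor
  · intro h
    -- On the sector the first alternatives of `h1` and `h2` fail, which leaves the two disks
    -- bounding `𝒟`. The pairs in `h3`, `h4`, `h5` give the red, blue and green alternatives, in
    -- this order.
    have h1 := h.sq_lt ⟨1, 0⟩ ⟨-1, 0⟩ (by decide) (by decide) (one_dvd _)
    have h2 := h.sq_lt ⟨1, 0⟩ ⟨-1, 1⟩ (by decide) (by decide) (one_dvd _)
    have h3 := h.sq_lt ⟨1, 0⟩ ⟨0, 1⟩ (by decide) (by decide) (one_dvd _)
    have h4 := h.sq_lt ⟨1, 0⟩ ⟨-1, -1⟩ (by decide) (by decide) (one_dvd _)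
    have h5 := h.sq_lt ⟨1, 1⟩ ⟨-1, 0⟩ (by decide) (by decide) (one_dvd _)
    have h6 := h.sq_lt ⟨1, 0⟩ ⟨1, 0⟩ (by decide) (by decide) (one_dvd _)
    have h7 := h.sq_lt ⟨1, 0⟩ ⟨0, -1⟩ (by decide) (by decide) (one_dvd _)
    norm_num at h1 h2 h3 h4 h5 h6 h7
    refine ⟨hw₁, ⟨hN1, ?_, ?_⟩, ?_, ?_, ?_, ?_⟩
    · rcases h1 with h1 | h1
      · nlinarith
      · linarith
    · rcases h2 with h2 | h2
      · nlinarith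
      · nlinarith
    -- If `w₁ = 0`, then `w₂` would be at distance more than 1 from each fourth root of unity, but
    -- the unit disks around these four points cover the unit disk.
    · rintro rfl
      simp at h1 h2 h3 h6 h7
      nlinarith [sq_nonneg (w₂.re - w₂.im), sq_nonneg (w₂.re + w₂.im)]
    · exact h3.symm.imp (fun h => by linarith) fun h => by linarith
    · exact h4.symm.imp (fun h => by linarith) fun h => by linarith
    · exact h5.symm.imp (fun h => by linarith) fun h => by linarith
  · rintro ⟨-, ⟨-, hD1, hD2⟩, h0, hA, hB, hC⟩
    have hM0 : 0 < w₁.re ^ 2 + w₁.im ^ 2 := by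
      rw [← sq_norm_eq]; exact pow_pos (norm_pos_iff.2 h0) 2
    refine admissible_of_first_quadrant one_ne_zero (norm_lt_one_iff.2 hM1) hw₂ ?_ ?_
    · have := half_le_sq_norm_one_sub w₁.re w₁.im w₂.re w₂.im _ _ rfl rfl hy hyx hM1 hN1 hD1 hD2 hA
      rw [sq_norm_eq (1 - w₁ * w₂)]
      simp
      nlinarith
    · intro p q hp₁ hp₂ hp hq hq0 _ h₁ h₂
      rw [sq_norm_add_mul] at h₁
      rw [sq_norm_mul_add] at h₂
      rw [map_one, norm_one, one_pow] at h₁ h₂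
      exact false_of_small_one w₁.re w₁.im w₂.re w₂.im _ _ rfl rfl hy hyx hM1 hN1 hM0 hD1 hD2 hA hB hC
        p.re p.im q.re q.im hp₁ hp₂ hp hq hq0 h₁ h₂

theorem mem_W₂zero_iff {w₁ w₂ : ℂ} : (w₁, w₂) ∈ W₂zero ↔ w₁ ∈ sectorC ∧
    1 < w₁.re ^ 2 + w₁.im ^ 2 + 2 * w₁.im ∧ w₂ ∈ regionT := by
  have : w₁ ∉ Metric.closedBall (-Complex.I) (√2) ↔ 1 < w₁.re ^ 2 + w₁.im ^ 2 + 2 * w₁.im := by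
    rw [notMem_closedBall_iff (Real.sqrt_nonneg 2)]
    simp
    constructor <;> intro h <;> nlinarith
  rw [W₂zero, Set.mem_prod, Set.mem_sdiff, this, and_assoc]

theorem one_add_I_dvd_iff {p : GaussianInt} : (⟨1, 1⟩ : GaussianInt) ∣ p ↔
    (p.re + p.im) % 2 = 0 := by
  constructor
  · rintro ⟨d, rfl⟩
    simp
    omega
  · intro h
    refine ⟨⟨(p.re + p.im) / 2, (p.im - p.re) / 2⟩, Zsqrtd.ext ?_ ?_⟩ <;> simp <;> omega

theorem admissible_one_add_I_iff {w₁ w₂ : ℂ} (hw₁ : w₁ ∈ sectorC) (hw₂ : ‖w₂‖ < 1) :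
    Admissible ⟨1, 1⟩ w₁ w₂ ↔ (w₁, w₂) ∈ W₂zero := by
  have hs := mem_sectorC_iff.1 hw₁
  obtain ⟨hM1, hy, hyx⟩ := hs
  have hN1 := norm_lt_one_iff.1 hw₂
  rw [mem_W₂zero_iff, mem_regionT_iff]
  constructor
  · intro h
    have h1 := h.sq_lt ⟨1, 0⟩ ⟨-1, 0⟩ (by decide) (by decide) (one_add_I_dvd_iff.2 (by decide))
    have h2 := h.sq_lt ⟨1, 0⟩ ⟨0, 1⟩ (by decide) (by decide) (one_add_I_dvd_iff.2 (by decide))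
    have h3 := h.sq_lt ⟨1, 0⟩ ⟨0, -1⟩ (by decide) (by decide) (one_add_I_dvd_iff.2 (by decide))
    norm_num at h1 h2 h3
    -- The sector lies within `√2` of 1 and of `i`, so `h1` and `h2` constrain `w₂`. They force
    -- `w₂.im > 0`, hence `|w₂ - i| < √2`, and `h3` then constrains `w₁`.
    have hT1 : 1 < w₂.re ^ 2 + w₂.im ^ 2 - 2 * w₂.re := by
      rcases h1 with h1 | h1 <;> nlinarith
    have hT2 : 1 < w₂.re ^ 2 + w₂.im ^ 2 + 2 * w₂.im := by
      rcases h2 with h2 | h2 <;> nlinarith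
    refine ⟨hw₁, ?_, hN1, hT1, hT2⟩
    rcases h3 with h3 | h3 <;> nlinarith
  · rintro ⟨-, hM2, -, hN2, hN3⟩
    refine admissible_of_first_quadrant (by decide) (norm_lt_one_iff.2 hM1) hw₂ ?_ ?_
    -- Here `w₂` is in the second quadrant, so `Re (w₁w₂) ≤ 0` and `|1 - w₁w₂| ≥ 1`.
    · rw [sq_norm_eq (1 - w₁ * w₂), sq_norm_toComplex]
      simp
      nlinarith [mul_nonneg (hy.trans hyx) (show 0 ≤ -w₂.re by linarith),
        mul_nonneg hy (show 0 ≤ w₂.im by linarith), sq_nonneg (w₁.re * w₂.im + w₁.im * w₂.re)]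
    · intro p q hp₁ hp₂ hp hq hq0 hpq h₁ h₂
      rw [one_add_I_dvd_iff] at hpq
      have hpq' : (p.re + p.im + q.re + q.im) % 2 = 0 := by
        simp at hpq
        omega
      rw [sq_norm_toComplex] at h₁ h₂
      rw [sq_norm_add_mul] at h₁
      rw [sq_norm_mul_add] at h₂
      norm_num only [Int.cast_one] at h₁ h₂
      exact false_of_small_two w₁.re w₁.im w₂.re w₂.im _ _ rfl rfl hy hyx hM1 hN1 hM2 hN2 hN3
        p.re p.im q.re q.im hp₁ hp₂ hp hq hq0 hpq' (by linarith) (by linarith)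

/-! ### The lattices `Ψ₁` and `Ψ₂` -/

theorem norm_uCoord (θ : ℝ) : ‖uCoord θ‖ = 1 := by
  rw [uCoord, mul_comm, Complex.norm_exp_ofReal_mul_I]

theorem norm_vCoord (k : ℕ) (θ : ℝ) (w₁ w₂ : ℂ) : ‖vCoord k θ w₁ w₂‖ = 1 := by
  rw [vCoord, mul_comm, Complex.norm_exp_ofReal_mul_I]

theorem one_sub_mul_ne_zero {w₁ w₂ : ℂ} (hw₁ : ‖w₁‖ < 1) (hw₂ : ‖w₂‖ < 1) :
    1 - w₁ * w₂ ≠ 0 := by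
  intro h
  have h1 : ‖w₁ * w₂‖ = 1 := by rw [← sub_eq_zero.1 h, norm_one]
  rw [norm_mul] at h1
  nlinarith [norm_nonneg w₁, norm_nonneg w₂]

theorem radius_pos {k : ℕ} (hk : 0 < k) {w₁ w₂ : ℂ} (h : 1 - w₁ * w₂ ≠ 0) :
    0 < radius k w₁ w₂ := by
  have := norm_pos_iff.2 h
  unfold radius
  positivity

theorem radius_sq_mul_norm (k : ℕ) {w₁ w₂ : ℂ} (h : 1 - w₁ * w₂ ≠ 0) :
    radius k w₁ w₂ ^ 2 * ‖1 - w₁ * w₂‖ = √k := by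
  rw [radius, div_pow, Real.sq_sqrt (norm_nonneg _), div_mul_cancel₀ _ (norm_ne_zero_iff.2 h),
    ← Real.rpow_natCast, ← Real.rpow_mul (Nat.cast_nonneg k), Real.sqrt_eq_rpow]
  norm_num

theorem uCoord_mul_vCoord (k : ℕ) (θ : ℝ) (w₁ w₂ : ℂ) :
    uCoord θ * vCoord k θ w₁ w₂ * Complex.exp (Complex.arg (1 - w₁ * w₂) * Complex.I) =
      Complex.exp (((k : ℂ) - 1) * (Real.pi / 4) * Complex.I) := by
  rw [uCoord, vCoord, ← Complex.exp_add, ← Complex.exp_add]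
  congr 1
  push_cast
  ring

/-- The determinant is `r² u₁ v₂ (1 - w₁w₂)`: the radius normalizes its modulus to `√k`, and the
argument chosen for `v₂` cancels those of `u₁` and `1 - w₁w₂`. -/
theorem det_uVec_vVec (k : ℕ) (θ : ℝ) {w₁ w₂ : ℂ} (h : 1 - w₁ * w₂ ≠ 0) :
    det (uVec k θ w₁ w₂) (vVec k θ w₁ w₂) =
      (√k : ℝ) * Complex.exp (((k : ℂ) - 1) * (Real.pi / 4) * Complex.I) := by
  rw [← uCoord_mul_vCoord k θ w₁ w₂, ← radius_sq_mul_norm k h]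
  have e := Complex.norm_mul_exp_arg_mul_I (1 - w₁ * w₂)
  simp only [det, uVec, vVec, Prod.smul_mk, Complex.real_smul, Complex.ofReal_mul,
    Complex.ofReal_pow]
  linear_combination (-(radius k w₁ w₂ : ℂ) ^ 2 * uCoord θ * vCoord k θ w₁ w₂) * e

theorem mem_TPiece_and_inter_iff {k : ℕ} {θ : ℝ} {w₁ w₂ : ℂ} {c : GaussianInt}
    {L : Submodule GaussianInt (ℂ × ℂ)} (hk : 0 < k) (hc : c ≠ 0)
    (hw₁ : ‖w₁‖ < 1) (hw₂ : ‖w₂‖ < 1) (hdet : det (uVec k θ w₁ w₂) (vVec k θ w₁ w₂) ≠ 0)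
    (huni : IsUnimodular L)
    (hL : ∀ z, z ∈ L ↔ ∃ p q : GaussianInt, c ∣ p - q ∧
      c • z = p • uVec k θ w₁ w₂ + q • vVec k θ w₁ w₂)
    (hindex : (Submodule.span GaussianInt
      {uVec k θ w₁ w₂, vVec k θ w₁ w₂}).toAddSubgroup.relIndex L.toAddSubgroup = k) :
    (L ∈ TPiece k ∧ (L : Set (ℂ × ℂ)) ∩ interior (Cyl k θ w₁ w₂) = {0}) ↔
      Admissible c w₁ w₂ := by
  have hr := radius_pos hk (one_sub_mul_ne_zero hw₁ hw₂)
  have he := norm_uCoord θ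
  have hf := norm_vCoord k θ w₁ w₂
  have nu1 : ‖(uVec k θ w₁ w₂).1‖ = radius k w₁ w₂ := by
    simp [uVec, he, abs_of_pos hr]
  have nv2 : ‖(vVec k θ w₁ w₂).2‖ = radius k w₁ w₂ := by
    simp [vVec, hf, abs_of_pos hr]
  have nu2 : ‖(uVec k θ w₁ w₂).2‖ < radius k w₁ w₂ := by
    simp only [uVec, Prod.smul_mk, norm_smul, Real.norm_of_nonneg hr.le, norm_mul, hf, one_mul]
    nlinarith
  have nv1 : ‖(vVec k θ w₁ w₂).1‖ < radius k w₁ w₂ := by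
    simp only [vVec, Prod.smul_mk, norm_smul, Real.norm_of_nonneg hr.le, norm_mul, he, one_mul]
    nlinarith
  rw [Cyl, interior_cylinder hr nu1 nv2 nu2 nv1]
  refine Iff.trans ?_ (isAssociated_iff_admissible hc hr he hf hw₁ hw₂ hdet hL)
  have huL : uVec k θ w₁ w₂ ∈ L := (hL _).2 ⟨c, 0, by simp, by rw [zero_smul, add_zero]⟩
  have hvL : vVec k θ w₁ w₂ ∈ L := (hL _).2 ⟨0, c, by simp, by rw [zero_smul, zero_add]⟩
  have hassoc := isAssociated_iff hr huL hvL nu1 nv2 nu2 nv1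
  refine Iff.trans ?_ hassoc
  constructor
  · rintro ⟨h, hint⟩
    exact ⟨h.1.2, hint⟩
  · rintro ⟨h, hint⟩
    refine ⟨⟨⟨huni, h⟩, _, _, hassoc.1 ⟨h, hint⟩, hindex⟩, hint⟩

theorem det_uVec_vVec_one (θ : ℝ) {w₁ w₂ : ℂ} (h : 1 - w₁ * w₂ ≠ 0) :
    det (uVec 1 θ w₁ w₂) (vVec 1 θ w₁ w₂) = 1 := by
  rw [det_uVec_vVec 1 θ h]
  simp

theorem det_uVec_vVec_two (θ : ℝ) {w₁ w₂ : ℂ} (h : 1 - w₁ * w₂ ≠ 0) :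
    det (uVec 2 θ w₁ w₂) (vVec 2 θ w₁ w₂) = 1 + Complex.I := by
  rw [det_uVec_vVec 2 θ h]
  have e : (((2 : ℕ) : ℂ) - 1) * (Real.pi / 4) * Complex.I =
      ((Real.pi / 4 : ℝ) : ℂ) * Complex.I := by push_cast; ring
  rw [e, Complex.exp_mul_I, ← Complex.ofReal_cos, ← Complex.ofReal_sin, Real.cos_pi_div_four,
    Real.sin_pi_div_four]
  have h2 : ((√2 : ℝ) : ℂ) * (√2 : ℝ) = 2 := by
    rw [← Complex.ofReal_mul, Real.mul_self_sqrt zero_le_two]; simp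
  push_cast
  linear_combination ((1 + Complex.I) / 2) * h2

theorem toComplex_one_add_I : ((⟨1, 1⟩ : GaussianInt) : ℂ) = 1 + Complex.I := by
  simp [GaussianInt.toComplex_def]

theorem one_add_I_ne_zero : (1 + Complex.I : ℂ) ≠ 0 := by
  intro h
  simpa using congrArg Complex.re h

theorem one_add_I_smul_half (u v : ℂ × ℂ) :
    (⟨1, 1⟩ : GaussianInt) • ((1 / (1 + Complex.I)) • (u + v)) = u + v := by
  have h := one_add_I_ne_zero
  rw [smul_prod_eq, toComplex_one_add_I]
  ext <;> simp <;> field_simp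

/-- The coordinates `m`, `n` in the basis correspond to `p = (1 + i) m + n` and `q = n`. -/
theorem mem_span_half_iff {u v z : ℂ × ℂ} :
    z ∈ Submodule.span GaussianInt {u, (1 / (1 + Complex.I)) • (u + v)} ↔
      ∃ p q : GaussianInt, (⟨1, 1⟩ : GaussianInt) ∣ p - q ∧
        (⟨1, 1⟩ : GaussianInt) • z = p • u + q • v := by
  have half := one_add_I_smul_half u v
  rw [mem_span_gaussianInt_pair]
  constructor
  · rintro ⟨m, n, rfl⟩
    refine ⟨⟨1, 1⟩ * m + n, n, by simp, ?_⟩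
    rw [smul_add, smul_comm _ n, half]
    module
  · rintro ⟨p, q, ⟨m, hm⟩, hz⟩
    refine ⟨m, q, ?_⟩
    have key : (⟨1, 1⟩ : GaussianInt) • (m • u + q • (1 / (1 + Complex.I)) • (u + v)) =
        (⟨1, 1⟩ : GaussianInt) • z := by
      rw [hz, smul_add, smul_comm _ q, half, sub_eq_iff_eq_add.1 hm]
      module
    exact gaussianInt_smul_left_cancel (by decide) key

/-- The vector `m u + n (u + v) / (1 + i)` is in the sublattice exactly when `1 + i` divides `n`, a
parity condition on `n.re + n.im`; adding `(u + v) / (1 + i)` flips that parity. -/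
theorem relIndex_span_half {u v : ℂ × ℂ} (h : det u v ≠ 0) :
    (Submodule.span GaussianInt {u, v}).toAddSubgroup.relIndex
      (Submodule.span GaussianInt {u, (1 / (1 + Complex.I)) • (u + v)}).toAddSubgroup = 2 := by
  have half := one_add_I_smul_half u v
  have mem_iff : ∀ m n : GaussianInt,
      m • u + n • ((1 / (1 + Complex.I)) • (u + v)) ∈ Submodule.span GaussianInt {u, v} ↔
        (n.re + n.im) % 2 = 0 := by
    intro m n
    rw [← one_add_I_dvd_iff, mem_span_gaussianInt_pair]
    constructor
    · rintro ⟨p, q, e⟩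
      refine ⟨q, GaussianInt.toComplex_inj.1 ?_⟩
      have e2 : (⟨1, 1⟩ * p) • u + (⟨1, 1⟩ * q) • v = (⟨1, 1⟩ * m + n) • u + n • v := by
        have := congrArg ((⟨1, 1⟩ : GaussianInt) • ·) e
        simp only [smul_add (⟨1, 1⟩ : GaussianInt), smul_comm _ n, half] at this
        rw [mul_smul, mul_smul, this]
        module
      have e3 := congrArg (det u) e2
      rw [det_smul_add_right, det_smul_add_right] at e3
      exact (mul_right_cancel₀ h e3).symm
    · rintro ⟨q, rfl⟩
      refine ⟨m + q, q, ?_⟩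
      rw [mul_comm, mul_smul, half]
      module
  rw [AddSubgroup.relIndex_eq_two_iff]
  refine ⟨(1 / (1 + Complex.I)) • (u + v), Submodule.subset_span (by simp), fun b hb => ?_⟩
  obtain ⟨m, n, rfl⟩ := mem_span_gaussianInt_pair.1 hb
  have e : m • u + n • ((1 / (1 + Complex.I)) • (u + v)) + (1 / (1 + Complex.I)) • (u + v) =
      m • u + (n + 1) • ((1 / (1 + Complex.I)) • (u + v)) := by
    rw [add_smul, one_smul, add_assoc]
  rw [e, Submodule.mem_toAddSubgroup, Submodule.mem_toAddSubgroup, mem_iff, mem_iff]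
  simp only [Zsqrtd.re_add, Zsqrtd.im_add, Zsqrtd.re_one, Zsqrtd.im_one, Xor]
  omega

end GaussTransversal

theorem mainTheorem9 (θ : ℝ) (hθ : θ ∈ Set.Ico 0 (Real.pi / 2)) (w₁ w₂ : ℂ)
    (hw₁ : w₁ ∈ Metric.ball (0 : ℂ) 1) (hw₂ : w₂ ∈ Metric.ball (0 : ℂ) 1) :
    ((GaussTransversal.Psi₁ θ w₁ w₂ ∈ GaussTransversal.TPiece 1 ∧
        (GaussTransversal.Psi₁ θ w₁ w₂ : Set (ℂ × ℂ)) ∩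
          interior (GaussTransversal.Cyl 1 θ w₁ w₂) = {0}) ↔
      (w₁, w₂) ∈ GaussTransversal.W₁) ∧
    ((GaussTransversal.Psi₂ θ w₁ w₂ ∈ GaussTransversal.TPiece 2 ∧
        (GaussTransversal.Psi₂ θ w₁ w₂ : Set (ℂ × ℂ)) ∩
          interior (GaussTransversal.Cyl 2 θ w₁ w₂) = {0}) ↔
      (w₁, w₂) ∈ GaussTransversal.W₂) := by
  open GaussTransversal in
  rw [mem_ball_zero_iff] at hw₁ hw₂
  have hne := one_sub_mul_ne_zero hw₁ hw₂
  constructor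
  · have hdet := det_uVec_vVec_one θ hne
    rw [W₁, ← admissible_iff_mem_orbit (one_dvd _) (one_dvd _)
      (fun w hw => ⟨hw.1, hw.2.1.1⟩) (fun w₁ h₁ w₂ h₂ => admissible_one_iff h₁ h₂) hw₁ hw₂]
    refine mem_TPiece_and_inter_iff one_pos one_ne_zero hw₁ hw₂ (by rw [hdet]; exact one_ne_zero)
      (isUnimodular_span_pair (by rw [hdet, one_pow])) (fun z => ?_)
      (AddSubgroup.relIndex_self _)
    rw [Psi₁, mem_span_gaussianInt_pair]
    simp only [isUnit_one, IsUnit.dvd, true_and, one_smul, eq_comm]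
  · have hdet := det_uVec_vVec_two θ hne
    have hdet0 : det (uVec 2 θ w₁ w₂) (vVec 2 θ w₁ w₂) ≠ 0 := by
      rw [hdet]; exact one_add_I_ne_zero
    rw [W₂, ← admissible_iff_mem_orbit (c := ⟨1, 1⟩) (one_add_I_dvd_iff.2 (by decide))
      (one_add_I_dvd_iff.2 (by decide)) (fun w hw => ⟨hw.1.1, hw.2.1⟩)
      (fun w₁ h₁ w₂ h₂ => admissible_one_add_I_iff h₁ h₂) hw₁ hw₂]
    refine mem_TPiece_and_inter_iff two_pos (by decide) hw₁ hw₂ hdet0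
      (isUnimodular_span_pair ?_) (fun z => mem_span_half_iff) (relIndex_span_half hdet0)
    have e : det (uVec 2 θ w₁ w₂) ((1 / (1 + Complex.I)) • (uVec 2 θ w₁ w₂ + vVec 2 θ w₁ w₂)) =
        1 / (1 + Complex.I) * det (uVec 2 θ w₁ w₂) (vVec 2 θ w₁ w₂) := by
      simp [det]; ring
    rw [e, hdet, one_div, inv_mul_cancel₀ one_add_I_ne_zero, one_pow]
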